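/- Conventions. Let $d\ge 1$. A state on $\mathbb C^d$ is a positive semidefinite $d\times d$ matrix of trace one. An ensemble $S=\{q_x,\rho_x\}_{x=1}^n$ consists of states $\rho_x$ on $\mathbb C^d$ and probabilities $q_x\ge 0$ with $\sum_x q_x=1$; for $d=2$ it is a qubit ensemble. A POVM is a family $M=\{M_x\}_{x=1}^n$ of positive semidefinite matrices with $\sum_x M_x=\mathbb I$; it identifies the indices in $\mathcal I=\{x: M_x\ne 0\}$. The guessing probability of $S$ is $P_g=\max_M\sum_x q_x\,\mathrm{tr}[M_x\rho_x]$, the maximum being over all POVMs, and a POVM is optimal for $S$ if it attains this maximum. States $\sigma_x$ and numbers $r_x\ge 0$ are complementary states of $S$ and their parameters if there are a matrix $K$ and a POVM $M'$ such that $K=q_x\rho_x+r_x\sigma_x$ and $r_x\,\mathrm{tr}[M'_x\sigma_x]=0$ for all $x$. A channel $\mathcal N$ is a completely positive, trace preserving linear map on the $d\times d$ matrices. Let $P_g^{(\mathcal N)}$ be the guessing probability of $S^{(\mathcal N)}=\{q_x,\mathcal N[\rho_x]\}_{x=1}^n$ and $\delta_{\mathcal N}=P_g-P_g^{(\mathcal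 N)}$. The channel $\mathcal N$ preserves an optimal measurement $M$ of $S$ if $M$ is optimal for $S^{(\mathcal N)}$ as well. Theorem. Let $S=\{q_x,\rho_x\}_{x=1}^n$ be an ensemble on $\mathbb C^d$ with complementary states $\sigma_x$ and parameters $r_x$, let $M$ be an optimal measurement for $S$, identifying the indices in $\mathcal I$, and let $\mathcal N$ be a channel. Consider the condition $$(\ast)\qquad q_x\mathcal N[\rho_x]-q_y\mathcal N[\rho_y]=q_x\rho_x-q_y\rho_y+\delta_{\mathcal N}(\sigma_x-\sigma_y)\quad\text{and}\quad r_x\ge\delta_{\mathcal N}\ge 0\qquad\text{for all }x,y\in\mathcal I .$$ 1. If $d=2$, then $\mathcal N$ preserves $M$ if and only if $(\ast)$ holds. 2. For every $d$, if $(\ast)$ holds, then $\mathcal N$ preserves $M$. 3. For every $d\ge 3$ the condition is not necessary: there are $S,\sigma_x,r_x,M,\mathcal N$ as above such that $\mathcal N$ preserves $M$ but $(\ast)$ fails. -/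

import Mathlib

namespace QDisc

open scoped MatrixOrder ComplexOrder Matrix.Norms.L2Operator CStarAlgebra

/-- Operators on the `d`-dimensional Hilbert space `ℂ^d`. -/
abbrev Op (d : ℕ) : Type := Matrix (Fin d) (Fin d) ℂ

/-- A quantum state (density matrix): a positive semidefinite (in particular Hermitian) operator
of trace one. -/
structure IsState {d : ℕ} (ρ : Op d) : Prop where
  posSemidef : ρ.PosSemidef
  trace_eq_one : ρ.trace = 1

/-- An ensemble `{q_x, ρ_x}` of `n` states in dimension `d`. -/
structure Ensemble (d n : ℕ) where
  /-- The a priori probabilities `q_x`. -/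
  prob : Fin n → ℝ
  /-- The states `ρ_x`. -/
  state : Fin n → Op d
  prob_nonneg : ∀ x, 0 ≤ prob x
  sum_prob : ∑ x, prob x = 1
  isState : ∀ x, IsState (state x)

/-- A quantum channel: a completely positive, trace preserving linear map. -/
structure Channel (d : ℕ) where
  /-- The underlying completely positive map. -/
  toCP : Op d →CP Op d
  trace_map : ∀ A : Op d, (toCP A).trace = A.trace

noncomputable instance (d : ℕ) : CoeFun (Channel d) (fun _ => Op d → Op d) := ⟨fun N A => N.toCP A⟩

theorem Channel.isState_map {d : ℕ} (N : Channel d) {ρ : Op d} (h : IsState ρ) :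
    IsState (N ρ) where
  posSemidef := by
    have h0 := h.posSemidef
    rw [← Matrix.nonneg_iff_posSemidef] at h0 ⊢
    exact map_nonneg N.toCP h0
  trace_eq_one := by rw [N.trace_map, h.trace_eq_one]

/-- The ensemble `{q_x, N[ρ_x]}` after the use of the channel `N`. -/
noncomputable def Ensemble.map {d n : ℕ} (S : Ensemble d n) (N : Channel d) : Ensemble d n where
  prob := S.prob
  state := fun x => N (S.state x)
  prob_nonneg := S.prob_nonneg
  sum_prob := S.sum_prob
  isState := fun x => N.isState_map (S.isState x)

/-- A measurement (POVM) with `n` outcomes. -/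
structure IsPOVM {d n : ℕ} (M : Fin n → Op d) : Prop where
  posSemidef : ∀ x, (M x).PosSemidef
  sum_eq_one : ∑ x, M x = 1

/-- The probability `∑ₓ q_x tr[M_x ρ_x]` of guessing correctly with the measurement `M`. -/
noncomputable def Ensemble.success {d n : ℕ} (S : Ensemble d n) (M : Fin n → Op d) : ℝ :=
  ∑ x, S.prob x * (M x * S.state x).trace.re

/-- The guessing probability `P_g`: the maximum of the success probability over all POVMs. -/
noncomputable def Ensemble.guessingProb {d n : ℕ} (S : Ensemble d n) : ℝ :=
  sSup {p : ℝ | ∃ M : Fin n → Op d, IsPOVM M ∧ p = S.success M}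

/-- `M` solves the minimum error discrimination problem for the ensemble `S`. -/
structure Ensemble.IsOptimal {d n : ℕ} (S : Ensemble d n) (M : Fin n → Op d) : Prop where
  isPOVM : IsPOVM M
  success_le : ∀ M' : Fin n → Op d, IsPOVM M' → S.success M' ≤ S.success M

/-- The index set of the states identified by the measurement `M`. -/
def identified {d n : ℕ} (M : Fin n → Op d) : Set (Fin n) := {x | M x ≠ 0}

/-- `σ_x` are complementary states of `S`, with parameters `r_x`: the Karush-Kuhn-Tucker conditions
`K = q_x ρ_x + r_x σ_x` and `r_x tr[M_x σ_x] = 0` hold for some symmetry operator `K` and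
some POVM `M`. -/
structure Ensemble.IsComplementary {d n : ℕ} (S : Ensemble d n) (σ : Fin n → Op d)
    (r : Fin n → ℝ) : Prop where
  isState : ∀ x, IsState (σ x)
  nonneg : ∀ x, 0 ≤ r x
  kkt : ∃ (K : Op d) (M : Fin n → Op d), IsPOVM M ∧
    (∀ x, K = S.prob x • S.state x + r x • σ x) ∧
    (∀ x, (r x : ℂ) * (M x * σ x).trace = 0)

/-- The guessing degradation `δ_N = P_g - P_g^{(N)}`. -/
noncomputable def Ensemble.degradation {d n : ℕ} (S : Ensemble d n) (N : Channel d) : ℝ :=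
  S.guessingProb - (S.map N).guessingProb

/-- The channel `N` preserves the optimal measurement `M` of `S`: the POVM `M` solves the
discrimination problem before and after the use of the channel. -/
def Ensemble.Preserves {d n : ℕ} (S : Ensemble d n) (N : Channel d) (M : Fin n → Op d) : Prop :=
  S.IsOptimal M ∧ (S.map N).IsOptimal M

/-- The conditions `q_x N[ρ_x] - q_y N[ρ_y] = q_x ρ_x - q_y ρ_y + δ_N (σ_x - σ_y)` and
`r_x ≥ δ_N ≥ 0` for all indices `x`, `y` identified by `M`. -/
def Ensemble.OMPCondition {d n : ℕ} (S : Ensemble d n) (N : Channel d) (M : Fin n → Op d)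
    (σ : Fin n → Op d) (r : Fin n → ℝ) : Prop :=
  ∀ x ∈ identified M, ∀ y ∈ identified M,
    S.prob x • N (S.state x) - S.prob y • N (S.state y) =
      S.prob x • S.state x - S.prob y • S.state y + S.degradation N • (σ x - σ y) ∧
    S.degradation N ≤ r x ∧ 0 ≤ S.degradation N

end QDisc

/-!
Semidefinite duality. If `M` is optimal for `S`, perturbing `M` shows that the Hermitian part `K` of
`∑ₓ q_x ρ_x M_x` dominates every `q_x ρ_x`; since `tr K = P_g`, each slack `K - q_x ρ_x` is
annihilated by `M_x`. Complementary states are the same data, with slack `r_x σ_x` and hence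
`r_x = P_g - q_x`.

If a channel preserves `M`, the slack after the channel is annihilated by `M_x` too. An effect of
corank at most one, such as any nonzero qubit effect, annihilates only operators `v wᵀ` with a fixed
`v`, so the two slacks are proportional; comparing traces, the new slack is `(r_x - δ) σ_x`, which
is `(∗)`. Conversely, `(∗)` makes `q_x N[ρ_x] + (r_x - δ) σ_x` independent of `x ∈ 𝓘`; its
slacks are annihilated by `M_x`, so `M` succeeds after the channel with probability the trace of
this operator, which is the guessing probability.

In dimension at least three the complement of a basis vector is at least two-dimensional, so a
channel can move a state within the support of its effect; this preserves `M` but violates `(∗)`.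
-/

namespace QDisc

open scoped MatrixOrder ComplexOrder Matrix.Norms.L2Operator CStarAlgebra Matrix

section Corank

variable {m n 𝕜 : Type*} [Fintype n]

theorem exists_forall_eq_vecMulVec_of_mul_eq_zero [Field 𝕜] {M : Matrix m n 𝕜}
    (hM : Fintype.card n ≤ M.rank + 1) :
    ∃ v : n → 𝕜, ∀ A : Matrix n n 𝕜, M * A = 0 → ∃ w, A = Matrix.vecMulVec v w := by
  have hker : Module.finrank 𝕜 (LinearMap.ker M.mulVecLin) ≤ 1 := by
    have := M.mulVecLin.finrank_range_add_finrank_ker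
    rw [Module.finrank_fintype_fun_eq_card] at this
    rw [Matrix.rank] at hM
    omega
  obtain ⟨v, hv⟩ := finrank_le_one_iff.mp hker
  refine ⟨v, fun A hA => ?_⟩
  have hcol (k : n) : ∃ c : 𝕜, c • (v : n → 𝕜) = A.col k := by
    have hmem : A.col k ∈ LinearMap.ker M.mulVecLin := by
      ext i
      exact congrFun (congrFun hA i) k
    exact (hv ⟨A.col k, hmem⟩).imp fun c hc => congrArg Subtype.val hc
  choose w hw using hcol
  refine ⟨w, Matrix.ext fun i k => ?_⟩
  rw [Matrix.vecMulVec_apply, mul_comm]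
  exact (congrFun (hw k) i).symm

theorem trace_smul_eq_trace_smul_of_mul_eq_zero [Field 𝕜] [StarRing 𝕜] {M : Matrix m n 𝕜}
    (hM : Fintype.card n ≤ M.rank + 1) {A B : Matrix n n 𝕜} (hA : A.IsHermitian)
    (hB : B.IsHermitian) (hMA : M * A = 0) (hMB : M * B = 0) :
    B.trace • A = A.trace • B := by
  obtain ⟨v, hv⟩ := exists_forall_eq_vecMulVec_of_mul_eq_zero hM
  have hmul {C D : Matrix n n 𝕜} (hC : M * C = 0) (hD : M * D = 0) : C * D = C.trace • D := by
    obtain ⟨a, rfl⟩ := hv C hC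
    obtain ⟨b, rfl⟩ := hv D hD
    rw [Matrix.vecMulVec_mul_vecMulVec, Matrix.trace_vecMulVec, dotProduct_comm,
      Matrix.vecMulVec_smul]
  calc B.trace • A = (A * B)ᴴ := by
        rw [Matrix.conjTranspose_mul, hA.eq, hB.eq, hmul hMB hMA]
    _ = A.trace • B := by
        rw [hmul hMA hMB, Matrix.conjTranspose_smul, ← Matrix.trace_conjTranspose, hA.eq, hB.eq]

theorem rank_pos_of_ne_zero [Field 𝕜] {M : Matrix m n 𝕜} (hM : M ≠ 0) : 0 < M.rank := by
  rw [Matrix.rank, Module.finrank_pos_iff, Submodule.nontrivial_iff_ne_bot, Ne,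
    LinearMap.range_eq_bot]
  intro h
  exact hM (Matrix.mulVec_injective (funext fun v => by
    rw [← Matrix.mulVecLin_apply, h, LinearMap.zero_apply, Matrix.zero_mulVec]))

end Corank

section PosSemidef

variable {n 𝕜 : Type*} [Fintype n] [RCLike 𝕜] {A B : Matrix n n 𝕜}

theorem trace_mul_nonneg (hA : A.PosSemidef) (hB : B.PosSemidef) : 0 ≤ (A * B).trace := by
  classical
  obtain ⟨C, rfl⟩ := CStarAlgebra.nonneg_iff_eq_star_mul_self.mp hA.nonneg
  rw [Matrix.mul_assoc, Matrix.trace_mul_comm]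
  exact (hB.mul_mul_conjTranspose_same C).trace_nonneg

theorem mul_eq_zero_of_trace_mul_eq_zero (hA : A.PosSemidef) (hB : B.PosSemidef)
    (h : (A * B).trace = 0) : A * B = 0 := by
  classical
  obtain ⟨C, rfl⟩ := CStarAlgebra.nonneg_iff_eq_star_mul_self.mp hA.nonneg
  obtain ⟨D, rfl⟩ := CStarAlgebra.nonneg_iff_eq_star_mul_self.mp hB.nonneg
  simp only [Matrix.star_eq_conjTranspose] at h ⊢
  have htrace : ((C * Dᴴ)ᴴ * (C * Dᴴ)).trace = (Cᴴ * C * (Dᴴ * D)).trace := by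
    rw [Matrix.conjTranspose_mul, Matrix.conjTranspose_conjTranspose, Matrix.mul_assoc,
      Matrix.trace_mul_comm]
    simp only [Matrix.mul_assoc]
  have hCD : C * Dᴴ = 0 := Matrix.trace_conjTranspose_mul_self_eq_zero_iff.mp (htrace.trans h)
  rw [Matrix.mul_assoc, ← Matrix.mul_assoc C, hCD, Matrix.zero_mul, Matrix.mul_zero]

theorem mul_eq_zero_of_re_trace_mul_eq_zero (hA : A.PosSemidef) (hB : B.PosSemidef)
    (h : RCLike.re (A * B).trace = 0) : A * B = 0 :=
  mul_eq_zero_of_trace_mul_eq_zero hA hB <|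
    RCLike.ext (by simpa using h)
      (by simpa using (RCLike.nonneg_iff.mp (trace_mul_nonneg hA hB)).2)

theorem posSemidef_of_forall_isStarProjection (hA : A.IsHermitian)
    (h : ∀ P : Matrix n n 𝕜, IsStarProjection P → 0 ≤ RCLike.re (P * A).trace) :
    A.PosSemidef := by
  classical
  refine hA.posSemidef_iff_eigenvalues_nonneg.mpr fun i => ?_
  set u : n → 𝕜 := (hA.eigenvectorBasis i).ofLp with hu
  have hnorm : star u ⬝ᵥ u = 1 := by
    rw [dotProduct_comm, ← EuclideanSpace.inner_eq_star_dotProduct,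
      inner_self_eq_norm_sq_to_K, hA.eigenvectorBasis.norm_eq_one]
    simp
  have hP : IsStarProjection (Matrix.vecMulVec u (star u)) :=
    ⟨by rw [IsIdempotentElem, Matrix.vecMulVec_mul_vecMulVec, hnorm, one_smul],
      (Matrix.posSemidef_vecMulVec_self_star u).isHermitian⟩
  have htrace : (Matrix.vecMulVec u (star u) * A).trace = hA.eigenvalues i := by
    rw [Matrix.trace_mul_comm, Matrix.mul_vecMulVec, Matrix.trace_vecMulVec, hu,
      hA.mulVec_eigenvectorBasis, smul_dotProduct, dotProduct_comm, hnorm]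
    simp [Algebra.smul_def]
  simpa [htrace] using h _ hP

end PosSemidef

variable {d n : ℕ}

theorem IsState.eq_trace_smul_of_mul_eq_zero {ρ A M : Op d} (hρ : IsState ρ)
    (hM : d ≤ M.rank + 1) (hA : A.IsHermitian) (hMA : M * A = 0) (hMρ : M * ρ = 0) :
    A = A.trace • ρ := by
  have := trace_smul_eq_trace_smul_of_mul_eq_zero (by simpa using hM) hA
    hρ.posSemidef.isHermitian hMA hMρ
  rwa [hρ.trace_eq_one, one_smul] at this

namespace Ensemble

variable (S : Ensemble d n) {K : Op d} {M : Fin n → Op d}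

/-- The slack operator `K - q_x ρ_x` of a candidate `K` for the dual problem: minimise `tr K`
subject to all slack operators being positive semidefinite. -/
noncomputable def slack (K : Op d) (x : Fin n) : Op d := K - S.prob x • S.state x

theorem success_eq_trace_sub (K : Op d) (hM : IsPOVM M) :
    S.success M = K.trace.re - ∑ x, (M x * S.slack K x).trace.re := by
  have hK : K.trace.re = ∑ x, (M x * K).trace.re := by
    rw [← Complex.re_sum, ← Matrix.trace_sum, ← Finset.sum_mul, hM.sum_eq_one, one_mul]
  rw [hK, ← Finset.sum_sub_distrib, success]
  refine Finset.sum_congr rfl fun x _ => ?_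
  simp only [slack, mul_sub, Matrix.mul_smul, Matrix.trace_sub, Matrix.trace_smul, Complex.sub_re,
    Complex.smul_re, smul_eq_mul, sub_sub_cancel]

theorem success_le_trace (hM : IsPOVM M) (hK : ∀ x, (S.slack K x).PosSemidef) :
    S.success M ≤ K.trace.re := by
  rw [S.success_eq_trace_sub K hM, sub_le_self_iff]
  exact Finset.sum_nonneg fun x _ =>
    (Complex.nonneg_iff.mp (trace_mul_nonneg (hM.posSemidef x) (hK x))).1

theorem trace_slack_re (K : Op d) (x : Fin n) :
    (S.slack K x).trace.re = K.trace.re - S.prob x := by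
  simp [slack, (S.isState x).trace_eq_one]

theorem success_le_one (hM : IsPOVM M) : S.success M ≤ 1 := by
  have htrace : (∑ y, S.prob y • S.state y).trace.re = 1 := by
    simp [Matrix.trace_sum, (S.isState _).trace_eq_one, S.sum_prob]
  rw [← htrace]
  refine S.success_le_trace hM fun x => ?_
  rw [slack, ← Finset.add_sum_erase _ _ (Finset.mem_univ x), add_sub_cancel_left]
  exact Matrix.posSemidef_sum _ fun y _ => (S.isState y).posSemidef.smul (S.prob_nonneg y)

variable {S}

theorem success_le_guessingProb (hM : IsPOVM M) : S.success M ≤ S.guessingProb :=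
  le_csSup ⟨1, by rintro _ ⟨M', hM', rfl⟩; exact S.success_le_one hM'⟩ ⟨M, hM, rfl⟩

theorem IsOptimal.guessingProb_eq (hM : S.IsOptimal M) : S.guessingProb = S.success M :=
  IsGreatest.csSup_eq
    ⟨⟨M, hM.isPOVM, rfl⟩, by rintro _ ⟨M', hM', rfl⟩; exact hM.success_le M' hM'⟩

theorem isOptimal_of_success_eq_guessingProb (hM : IsPOVM M) (h : S.success M = S.guessingProb) :
    S.IsOptimal M :=
  ⟨hM, fun _ hM' => (success_le_guessingProb hM').trans_eq h.symm⟩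

theorem isOptimal_of_success_eq_one (hM : IsPOVM M) (h : S.success M = 1) : S.IsOptimal M :=
  ⟨hM, fun _ hM' => (S.success_le_one hM').trans_eq h.symm⟩

theorem identified_nonempty (S : Ensemble d n) (hM : IsPOVM M) : (identified M).Nonempty := by
  by_contra hempty
  have hzero (x : Fin n) : M x = 0 := by
    by_contra hx
    exact hempty ⟨x, hx⟩
  have hone : (0 : Op d) = 1 := by simpa only [hzero, Finset.sum_const_zero] using hM.sum_eq_one
  have hprob (x : Fin n) : False := by
    simpa [eq_zero_of_zero_eq_one hone (S.state x)] using (S.isState x).trace_eq_one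
  simpa [Finset.sum_eq_zero fun x _ => (hprob x).elim] using S.sum_prob

/-- The symmetry operators of `S`: the optimal points of the dual problem, which has the same value
`P_g` as the discrimination problem. -/
structure IsSymmetryOp (S : Ensemble d n) (K : Op d) : Prop where
  posSemidef_slack : ∀ x, (S.slack K x).PosSemidef
  trace_re : K.trace.re = S.guessingProb

theorem isSymmetryOp_of_success_eq (hM : IsPOVM M) (hK : ∀ x, (S.slack K x).PosSemidef)
    (h : S.success M = K.trace.re) : S.IsSymmetryOp K where
  posSemidef_slack := hK
  trace_re := by
    have hopt : S.IsOptimal M := ⟨hM, fun _ hM' => (S.success_le_trace hM' hK).trans_eq h.symm⟩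
    rw [hopt.guessingProb_eq, h]

theorem IsSymmetryOp.mul_slack_eq_zero (hK : S.IsSymmetryOp K) (hM : S.IsOptimal M) (x : Fin n) :
    M x * S.slack K x = 0 := by
  have hnonneg (y : Fin n) : 0 ≤ (M y * S.slack K y).trace.re :=
    (Complex.nonneg_iff.mp
      (trace_mul_nonneg (hM.isPOVM.posSemidef y) (hK.posSemidef_slack y))).1
  have hsum : ∑ y, (M y * S.slack K y).trace.re = 0 := by
    have := S.success_eq_trace_sub K hM.isPOVM
    rw [hK.trace_re, hM.guessingProb_eq] at this
    linarith
  refine mul_eq_zero_of_re_trace_mul_eq_zero (hM.isPOVM.posSemidef x) (hK.posSemidef_slack x) ?_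
  exact (Finset.sum_eq_zero_iff_of_nonneg fun y _ => hnonneg y).mp hsum x (Finset.mem_univ x)

section StrongDuality

theorem success_add (M M' : Fin n → Op d) : S.success (M + M') = S.success M + S.success M' := by
  simp [success, add_mul, mul_add, Finset.sum_add_distrib]

theorem success_sub (M M' : Fin n → Op d) : S.success (M - M') = S.success M - S.success M' := by
  simp [success, sub_mul, mul_sub, Finset.sum_sub_distrib]

theorem success_smul (c : ℝ) (M : Fin n → Op d) : S.success (c • M) = c * S.success M := by
  simp [success, Finset.mul_sum, mul_left_comm]

theorem success_single (j : Fin n) (A : Op d) :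
    S.success (Pi.single j A) = S.prob j * (A * S.state j).trace.re := by
  rw [success, Finset.sum_eq_single_of_mem j (Finset.mem_univ j), Pi.single_eq_same]
  intro x _ hx
  rw [Pi.single_eq_of_ne hx, zero_mul, Matrix.trace_zero, Complex.zero_re, mul_zero]

/-- The Hermitian part of `∑ₓ q_x ρ_x M_x`, which is the symmetry operator when `M` is optimal.
Taking the Hermitian part makes the slack operators Hermitian for every measurement `M`. -/
noncomputable def lagrangeOp (S : Ensemble d n) (M : Fin n → Op d) : Op d :=
  ∑ x, (S.prob x / 2) • (S.state x * M x + M x * S.state x)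

theorem lagrangeOp_isHermitian (hM : IsPOVM M) : (S.lagrangeOp M).IsHermitian := by
  rw [Matrix.IsHermitian, lagrangeOp, Matrix.conjTranspose_sum]
  refine Finset.sum_congr rfl fun x _ => ?_
  rw [Matrix.conjTranspose_smul, Matrix.conjTranspose_add, Matrix.conjTranspose_mul,
    Matrix.conjTranspose_mul, (hM.posSemidef x).isHermitian.eq,
    (S.isState x).posSemidef.isHermitian.eq, add_comm, star_trivial]

theorem two_mul_trace_mul_lagrangeOp_re (P : Op d) (M : Fin n → Op d) :
    2 * (P * S.lagrangeOp M).trace.re = S.success fun x => P * M x + M x * P := by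
  rw [lagrangeOp, Finset.mul_sum, Matrix.trace_sum, Complex.re_sum, Finset.mul_sum, success]
  refine Finset.sum_congr rfl fun x _ => ?_
  have hcycle : (P * (S.state x * M x)).trace = (M x * P * S.state x).trace := by
    rw [← Matrix.mul_assoc, Matrix.trace_mul_comm, Matrix.mul_assoc]
  simp only [Matrix.mul_smul, mul_add, add_mul, Matrix.trace_smul, Matrix.trace_add, hcycle,
    Complex.smul_re, Complex.add_re, smul_eq_mul, Matrix.mul_assoc]
  ring

theorem trace_lagrangeOp_re (M : Fin n → Op d) : (S.lagrangeOp M).trace.re = S.success M := by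
  have h := two_mul_trace_mul_lagrangeOp_re (S := S) 1 M
  simp only [one_mul, mul_one] at h
  have hadd := success_add (S := S) M M
  rw [Pi.add_def] at hadd
  linarith

end StrongDuality

end Ensemble

/-- The measurement obtained from `M` by compressing every effect with `1 - ε P`, for a projection
`P`, and giving the released weight `1 - (1 - ε P)² = ε (2 - ε) P` to the outcome `j`. The
derivative at `ε = 0` tests the optimality of `M`. -/
noncomputable def tilt (M : Fin n → Op d) (j : Fin n) (P : Op d) (ε : ℝ) : Fin n → Op d :=
  (fun x => (1 - ε • P) * M x * (1 - ε • P)) + Pi.single j ((ε * (2 - ε)) • P)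

section Tilt

variable {M : Fin n → Op d} {P : Op d}

theorem isPOVM_tilt (hM : IsPOVM M) (j : Fin n) (hP : IsStarProjection P) {ε : ℝ} (hε₀ : 0 ≤ ε)
    (hε₂ : ε ≤ 2) : IsPOVM (tilt M j P ε) where
  posSemidef x := by
    have hself : (1 - ε • P)ᴴ = 1 - ε • P := by
      rw [Matrix.conjTranspose_sub, Matrix.conjTranspose_one, Matrix.conjTranspose_smul,
        star_trivial, ← Matrix.star_eq_conjTranspose, hP.isSelfAdjoint]
    have hcompress : ((1 - ε • P) * M x * (1 - ε • P)).PosSemidef := by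
      have := (hM.posSemidef x).mul_mul_conjTranspose_same (1 - ε • P)
      rwa [hself] at this
    have hweight : 0 ≤ (ε * (2 - ε)) • P :=
      smul_nonneg (mul_nonneg hε₀ (sub_nonneg.mpr hε₂)) hP.nonneg
    have hsingle : (0 : Fin n → Op d) ≤ Pi.single j ((ε * (2 - ε)) • P) :=
      Pi.single_nonneg.mpr hweight
    rw [tilt, Pi.add_apply]
    exact hcompress.add (Matrix.nonneg_iff_posSemidef.mp (hsingle x))
  sum_eq_one := by
    simp only [tilt, Pi.add_apply, Finset.sum_add_distrib, Finset.sum_pi_single', Finset.mem_univ,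
      if_true, ← Finset.sum_mul, ← Finset.mul_sum, hM.sum_eq_one]
    simp only [mul_one, sub_mul, mul_sub, one_mul, smul_mul_smul_comm, hP.isIdempotentElem.eq]
    module

theorem tilt_eq (M : Fin n → Op d) (j : Fin n) (P : Op d) (ε : ℝ) :
    tilt M j P ε = M + ε • (Pi.single j ((2 : ℝ) • P) - fun x => P * M x + M x * P) +
      ε ^ 2 • ((fun x => P * M x * P) - Pi.single j P) := by
  funext x
  have hsingle (c : ℝ) : (Pi.single j (c • P) : Fin n → Op d) x =
      c • (Pi.single j P : Fin n → Op d) x := by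
    rw [Pi.single_smul, Pi.smul_apply]
  simp only [tilt, Pi.add_apply, Pi.sub_apply, Pi.smul_apply, hsingle, sub_mul, mul_sub, one_mul,
    mul_one, Matrix.smul_mul, Matrix.mul_smul]
  module

end Tilt

theorem nonpos_of_forall_mul_add_sq_mul_nonpos {a b : ℝ}
    (h : ∀ ε : ℝ, 0 < ε → ε ≤ 1 → ε * a + ε ^ 2 * b ≤ 0) : a ≤ 0 := by
  have hlim : Filter.Tendsto (fun ε : ℝ => a + ε * b) (nhdsWithin 0 (Set.Ioi 0)) (nhds a) := by
    have hcont : Continuous fun ε : ℝ => a + ε * b := by fun_prop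
    exact (hcont.tendsto' 0 a (by rw [zero_mul, add_zero])).mono_left nhdsWithin_le_nhds
  refine le_of_tendsto hlim ?_
  filter_upwards [Ioc_mem_nhdsGT one_pos] with ε hε
  refine nonpos_of_mul_nonpos_right ?_ hε.1
  linarith [h ε hε.1 hε.2]

namespace Ensemble

variable {S : Ensemble d n} {K : Op d} {M : Fin n → Op d}

theorem IsOptimal.trace_mul_slack_lagrangeOp_re_nonneg (hM : S.IsOptimal M) (j : Fin n) {P : Op d}
    (hP : IsStarProjection P) : 0 ≤ (P * S.slack (S.lagrangeOp M) j).trace.re := by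
  have hderiv : S.success (Pi.single j ((2 : ℝ) • P) - fun x => P * M x + M x * P) ≤ 0 := by
    refine nonpos_of_forall_mul_add_sq_mul_nonpos
      (b := S.success ((fun x => P * M x * P) - Pi.single j P)) fun ε hε₀ hε₁ => ?_
    have hle := hM.success_le _ (isPOVM_tilt hM.isPOVM j hP hε₀.le (by linarith))
    rw [tilt_eq, success_add, success_add, success_smul, success_smul] at hle
    linarith
  rw [success_sub, success_single, ← two_mul_trace_mul_lagrangeOp_re] at hderiv
  simp only [slack, mul_sub, Matrix.smul_mul, Matrix.mul_smul, Matrix.trace_sub,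
    Matrix.trace_smul, Complex.sub_re, Complex.smul_re, smul_eq_mul] at hderiv ⊢
  linarith

theorem IsOptimal.isSymmetryOp_lagrangeOp (hM : S.IsOptimal M) :
    S.IsSymmetryOp (S.lagrangeOp M) := by
  refine isSymmetryOp_of_success_eq hM.isPOVM (fun j => ?_) (trace_lagrangeOp_re M).symm
  have hherm : (S.slack (S.lagrangeOp M) j).IsHermitian :=
    (lagrangeOp_isHermitian hM.isPOVM).sub
      ((S.isState j).posSemidef.smul (S.prob_nonneg j)).isHermitian
  exact posSemidef_of_forall_isStarProjection hherm fun P hP =>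
    hM.trace_mul_slack_lagrangeOp_re_nonneg j hP

namespace IsComplementary

variable {σ : Fin n → Op d} {r : Fin n → ℝ}

theorem exists_isSymmetryOp (h : S.IsComplementary σ r) :
    ∃ K, S.IsSymmetryOp K ∧ ∀ x, S.slack K x = r x • σ x := by
  obtain ⟨K, M, hM, hK, horth⟩ := h.kkt
  have hslack (x : Fin n) : S.slack K x = r x • σ x := sub_eq_iff_eq_add'.mpr (hK x)
  refine ⟨K, isSymmetryOp_of_success_eq hM
    (fun x => hslack x ▸ (h.isState x).posSemidef.smul (h.nonneg x)) ?_, hslack⟩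
  rw [S.success_eq_trace_sub K hM, Finset.sum_eq_zero, sub_zero]
  intro x _
  simpa [hslack] using congrArg Complex.re (horth x)

theorem param_eq (h : S.IsComplementary σ r) (x : Fin n) : r x = S.guessingProb - S.prob x := by
  obtain ⟨K, hK, hslack⟩ := h.exists_isSymmetryOp
  have htrace := S.trace_slack_re K x
  rw [hslack, hK.trace_re] at htrace
  simpa [(h.isState x).trace_eq_one] using htrace

theorem eq_zero_or_mul_eq_zero (h : S.IsComplementary σ r) (hM : S.IsOptimal M) (x : Fin n) :
    r x = 0 ∨ M x * σ x = 0 := by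
  obtain ⟨K, hK, hslack⟩ := h.exists_isSymmetryOp
  have := hK.mul_slack_eq_zero hM x
  rwa [hslack, Matrix.mul_smul, smul_eq_zero] at this

theorem sub_eq_iff_add_smul_eq (h : S.IsComplementary σ r) (A B : Op d) (δ : ℝ) (x y : Fin n) :
    A - B = S.prob x • S.state x - S.prob y • S.state y + δ • (σ x - σ y) ↔
      A + (r x - δ) • σ x = B + (r y - δ) • σ y := by
  obtain ⟨K, -, hslack⟩ := h.exists_isSymmetryOp
  have hstate (z : Fin n) : S.prob z • S.state z = K - r z • σ z := by
    rw [← hslack, slack, sub_sub_cancel]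
  rw [hstate, hstate]
  constructor <;> intro hAB
  · rw [sub_eq_iff_eq_add.mp hAB]
    module
  · rw [eq_sub_of_add_eq hAB]
    module

end IsComplementary

theorem slack_map {N : Channel d} (K : Op d) (x : Fin n) :
    (S.map N).slack (N K) x = N (S.slack K x) := by
  change N K - S.prob x • N (S.state x) = N (K - S.prob x • S.state x)
  have hsub : N (K - S.prob x • S.state x) = N K - N (S.prob x • S.state x) := map_sub N.toCP _ _
  have hsmul : N ((S.prob x : ℂ) • S.state x) = (S.prob x : ℂ) • N (S.state x) :=
    map_smul N.toCP _ _
  rw [hsub, ← Complex.coe_smul, ← Complex.coe_smul, hsmul]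

theorem IsSymmetryOp.degradation_nonneg {N : Channel d} (hK : S.IsSymmetryOp K)
    (hM : (S.map N).IsOptimal M) : 0 ≤ S.degradation N := by
  have hslack (x : Fin n) : ((S.map N).slack (N K) x).PosSemidef := by
    rw [slack_map]
    exact Matrix.nonneg_iff_posSemidef.mp (map_nonneg N.toCP (hK.posSemidef_slack x).nonneg)
  rw [degradation, sub_nonneg, ← hK.trace_re, ← N.trace_map K, hM.guessingProb_eq]
  exact (S.map N).success_le_trace hM.isPOVM hslack

section

variable {σ : Fin n → Op d} {r : Fin n → ℝ} {N : Channel d}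

theorem IsComplementary.trace_slack_map_re (h : S.IsComplementary σ r)
    (hK : (S.map N).IsSymmetryOp K) (x : Fin n) :
    ((S.map N).slack K x).trace.re = r x - S.degradation N := by
  rw [trace_slack_re, hK.trace_re, h.param_eq, degradation]
  simp only [map]
  ring

theorem Preserves.slack_map_eq (hN : S.Preserves N M) (h : S.IsComplementary σ r)
    (hK : (S.map N).IsSymmetryOp K) {x : Fin n} (hx : d ≤ (M x).rank + 1) :
    (S.map N).slack K x = (r x - S.degradation N) • σ x := by
  obtain ⟨K₀, hK₀, -⟩ := h.exists_isSymmetryOp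
  have hpos := hK.posSemidef_slack x
  have htrace : ((S.map N).slack K x).trace = ((r x - S.degradation N : ℝ) : ℂ) := by
    rw [← h.trace_slack_map_re hK x]
    exact Complex.ext rfl (Complex.nonneg_iff.mp hpos.trace_nonneg).2.symm
  rcases h.eq_zero_or_mul_eq_zero hN.1 x with hr | hMσ
  · have hle : r x - S.degradation N ≤ 0 := by linarith [hK₀.degradation_nonneg hN.2]
    have hge : 0 ≤ r x - S.degradation N := by
      rw [← h.trace_slack_map_re hK x]
      exact (Complex.nonneg_iff.mp hpos.trace_nonneg).1
    have hzero : r x - S.degradation N = 0 := le_antisymm hle hge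
    rw [hzero, zero_smul]
    exact hpos.trace_eq_zero_iff.mp (by rw [htrace, hzero, Complex.ofReal_zero])
  · rw [← Complex.coe_smul, ← htrace]
    exact (h.isState x).eq_trace_smul_of_mul_eq_zero hx hpos.isHermitian
      (hK.mul_slack_eq_zero hN.2 x) hMσ

theorem Preserves.ompCondition (hN : S.Preserves N M) (h : S.IsComplementary σ r)
    (hrank : ∀ x ∈ identified M, d ≤ (M x).rank + 1) : S.OMPCondition N M σ r := by
  obtain ⟨K, hK, -⟩ := h.exists_isSymmetryOp
  have hK' := hN.2.isSymmetryOp_lagrangeOp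
  set K' := (S.map N).lagrangeOp M
  have hsum {x : Fin n} (hx : x ∈ identified M) :
      S.prob x • N (S.state x) + (r x - S.degradation N) • σ x = K' := by
    rw [← hN.slack_map_eq h hK' (hrank x hx)]
    exact add_sub_cancel _ _
  refine fun x hx y hy => ⟨?_, ?_, hK.degradation_nonneg hN.2⟩
  · rw [h.sub_eq_iff_add_smul_eq, hsum hx, hsum hy]
  · rw [← sub_nonneg, ← h.trace_slack_map_re hK' x]
    exact (Complex.nonneg_iff.mp (hK'.posSemidef_slack x).trace_nonneg).1

theorem OMPCondition.preserves (hC : S.OMPCondition N M σ r) (h : S.IsComplementary σ r)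
    (hM : S.IsOptimal M) : S.Preserves N M := by
  obtain ⟨x₀, hx₀⟩ := S.identified_nonempty hM.isPOVM
  set K' := S.prob x₀ • N (S.state x₀) + (r x₀ - S.degradation N) • σ x₀ with hK'
  have htrace : K'.trace.re = (S.map N).guessingProb := by
    simp only [hK', Matrix.trace_add, Matrix.trace_smul, (h.isState x₀).trace_eq_one,
      (N.isState_map (S.isState x₀)).trace_eq_one, Complex.add_re, Complex.smul_re, Complex.one_re,
      smul_eq_mul, mul_one, h.param_eq x₀, degradation]
    ring
  have hslack {x : Fin n} (hx : x ∈ identified M) :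
      (S.map N).slack K' x = (r x - S.degradation N) • σ x :=
    sub_eq_iff_eq_add'.mpr ((h.sub_eq_iff_add_smul_eq _ _ _ _ _).mp (hC x₀ hx₀ x hx).1)
  have horth (x : Fin n) : M x * (S.map N).slack K' x = 0 := by
    by_cases hx : M x = 0
    · rw [hx, zero_mul]
    obtain ⟨-, hδr, hδ⟩ := hC x hx x hx
    rw [hslack hx, Matrix.mul_smul, smul_eq_zero]
    exact (h.eq_zero_or_mul_eq_zero hM x).imp_left fun hr => by linarith
  refine ⟨hM, isOptimal_of_success_eq_guessingProb hM.isPOVM ?_⟩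
  rw [(S.map N).success_eq_trace_sub K' hM.isPOVM, ← htrace]
  simp only [horth, Matrix.trace_zero, Complex.zero_re, Finset.sum_const_zero, sub_zero]

end

end Ensemble

section Counterexample

/-- Relabelling the basis vectors by a permutation, as a star algebra homomorphism. -/
def permHom (e : Equiv.Perm (Fin d)) : Op d →⋆ₐ[ℂ] Op d where
  toFun A := A.submatrix e e
  map_one' := Matrix.submatrix_one_equiv e
  map_mul' A B := (Matrix.submatrix_mul_equiv A B e e e).symm
  map_zero' := rfl
  map_add' _ _ := rfl
  commutes' c := by
    simp only [Algebra.algebraMap_eq_smul_one, Matrix.submatrix_smul, Pi.smul_apply,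
      Matrix.submatrix_one_equiv]
  map_star' _ := rfl

/-- The unitary channel permuting the basis vectors; it sends the `e i`-th basis state to the
`i`-th one. -/
noncomputable def permChannel (e : Equiv.Perm (Fin d)) : Channel d where
  toCP := CompletelyPositiveMapClass.toCompletelyPositiveLinearMap (permHom e)
  trace_map A := Equiv.sum_comp e fun i => A i i

/-- The pure state of the `i`-th basis vector. -/
noncomputable def basisState (i : Fin d) : Op d := Matrix.single i i 1

theorem isStarProjection_basisState (i : Fin d) : IsStarProjection (basisState i) where
  isIdempotentElem := by
    rw [IsIdempotentElem, basisState, Matrix.single_mul_single_same, one_mul]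
  isSelfAdjoint := by
    rw [IsSelfAdjoint, Matrix.star_eq_conjTranspose, basisState, Matrix.conjTranspose_single,
      star_one]

theorem isState_basisState (i : Fin d) : IsState (basisState i) where
  posSemidef := Matrix.nonneg_iff_posSemidef.mp (isStarProjection_basisState i).nonneg
  trace_eq_one := Matrix.trace_single_eq_same i 1

theorem basisState_mul_basisState_of_ne {i j : Fin d} (hij : i ≠ j) :
    basisState i * basisState j = 0 :=
  Matrix.single_mul_single_of_ne _ i i j hij 1

theorem basisState_injective : Function.Injective (basisState (d := d)) := fun i j h => by
  simpa [basisState, Matrix.single_apply] using congrFun (congrFun h j) j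

theorem permChannel_basisState (e : Equiv.Perm (Fin d)) (i : Fin d) :
    permChannel e (basisState (e i)) = basisState i := by
  change (basisState (e i)).submatrix e e = basisState i
  rw [basisState, basisState, Matrix.submatrix_single_equiv, Equiv.symm_apply_apply]

/-- The ensemble of two basis states with equal a priori probabilities. -/
noncomputable def basisEnsemble (i j : Fin d) : Ensemble d 2 where
  prob _ := 1 / 2
  state := ![basisState i, basisState j]
  prob_nonneg _ := by norm_num
  sum_prob := by norm_num
  isState := Fin.forall_fin_two.mpr ⟨isState_basisState i, isState_basisState j⟩

theorem basisEnsemble_map_permChannel (e : Equiv.Perm (Fin d)) (i j : Fin d) :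
    (basisEnsemble (e i) (e j)).map (permChannel e) = basisEnsemble i j := by
  simp only [Ensemble.map, basisEnsemble, Ensemble.mk.injEq, true_and]
  exact funext <| Fin.forall_fin_two.mpr
    ⟨permChannel_basisState e i, permChannel_basisState e j⟩

/-- The measurement separating a basis vector from its orthogonal complement. -/
noncomputable def basisPOVM (i : Fin d) : Fin 2 → Op d := ![basisState i, 1 - basisState i]

theorem isPOVM_basisPOVM (i : Fin d) : IsPOVM (basisPOVM i) where
  posSemidef := Fin.forall_fin_two.mpr ⟨(isState_basisState i).posSemidef,
    Matrix.nonneg_iff_posSemidef.mp (isStarProjection_basisState i).one_sub.nonneg⟩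
  sum_eq_one := by
    rw [Fin.sum_univ_two]
    exact add_sub_cancel _ _

theorem identified_basisPOVM {i j : Fin d} (hij : i ≠ j) (x : Fin 2) :
    x ∈ identified (basisPOVM i) := by
  have hne (k : Fin d) : basisState k ≠ 0 := fun h => by
    simpa [h] using (isState_basisState k).trace_eq_one
  revert x
  refine Fin.forall_fin_two.mpr ⟨hne i, fun h => hne j ?_⟩
  rw [← one_mul (basisState j), sub_eq_zero.mp h, basisState_mul_basisState_of_ne hij]

theorem basisEnsemble_isComplementary {i j : Fin d} (hij : i ≠ j) :
    (basisEnsemble i j).IsComplementary ![basisState j, basisState i] fun _ => 1 / 2 where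
  isState := Fin.forall_fin_two.mpr ⟨isState_basisState j, isState_basisState i⟩
  nonneg _ := by norm_num
  kkt := by
    refine ⟨(1 / 2 : ℝ) • basisState i + (1 / 2 : ℝ) • basisState j, basisPOVM i,
      isPOVM_basisPOVM i, Fin.forall_fin_two.mpr ⟨rfl, add_comm _ _⟩,
      Fin.forall_fin_two.mpr ⟨?_, ?_⟩⟩
    · simp [basisPOVM, basisState_mul_basisState_of_ne hij]
    · simp [basisPOVM, sub_mul, (isStarProjection_basisState i).isIdempotentElem.eq]

theorem basisEnsemble_success_basisPOVM {i j : Fin d} (hij : i ≠ j) :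
    (basisEnsemble i j).success (basisPOVM i) = 1 := by
  rw [Ensemble.success, Fin.sum_univ_two]
  simp only [basisEnsemble, basisPOVM, Matrix.cons_val_zero, Matrix.cons_val_one, sub_mul, one_mul,
    basisState_mul_basisState_of_ne hij, (isStarProjection_basisState i).isIdempotentElem.eq,
    sub_zero, (isState_basisState _).trace_eq_one, Complex.one_re]
  norm_num

theorem exists_preserves_not_ompCondition (hd : 2 < d) :
    ∃ (n : ℕ) (S : Ensemble d n) (σ : Fin n → Op d) (r : Fin n → ℝ)
      (M : Fin n → Op d) (N : Channel d),
      S.IsComplementary σ r ∧ S.IsOptimal M ∧ S.Preserves N M ∧ ¬ S.OMPCondition N M σ r := by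
  obtain ⟨i, j, k, hij, hik, hjk⟩ : ∃ i j k : Fin d, i ≠ j ∧ i ≠ k ∧ j ≠ k :=
    ⟨⟨0, by omega⟩, ⟨1, by omega⟩, ⟨2, hd⟩, by simp, by simp, by simp⟩
  set e := Equiv.swap j k
  have hei : e i = i := Equiv.swap_apply_of_ne_of_ne hij hik
  have hek : e k = j := Equiv.swap_apply_right j k
  have hmap : (basisEnsemble i j).map (permChannel e) = basisEnsemble i k := by
    simpa only [hei, hek] using basisEnsemble_map_permChannel e i k
  have hM := basisEnsemble_success_basisPOVM hij
  have hM' : ((basisEnsemble i j).map (permChannel e)).success (basisPOVM i) = 1 := by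
    rw [hmap, basisEnsemble_success_basisPOVM hik]
  have hopt := Ensemble.isOptimal_of_success_eq_one (isPOVM_basisPOVM i) hM
  have hopt' := Ensemble.isOptimal_of_success_eq_one (isPOVM_basisPOVM i) hM'
  refine ⟨2, basisEnsemble i j, _, _, basisPOVM i, permChannel e,
    basisEnsemble_isComplementary hij, hopt, ⟨hopt, hopt'⟩, fun hC => hjk ?_⟩
  have hδ : (basisEnsemble i j).degradation (permChannel e) = 0 := by
    rw [Ensemble.degradation, hopt.guessingProb_eq, hopt'.guessingProb_eq, hM, hM', sub_self]
  have hdiff := (hC 0 (identified_basisPOVM hij 0) 1 (identified_basisPOVM hij 1)).1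
  have hNi : permChannel e (basisState i) = basisState i := by
    simpa only [hei] using permChannel_basisState e i
  have hNj : permChannel e (basisState j) = basisState k := by
    simpa only [hek] using permChannel_basisState e k
  rw [hδ, zero_smul, add_zero] at hdiff
  change (1 / 2 : ℝ) • permChannel e (basisState i) - (1 / 2 : ℝ) • permChannel e (basisState j) =
    (1 / 2 : ℝ) • basisState i - (1 / 2 : ℝ) • basisState j at hdiff
  rw [hNi, hNj, sub_right_inj] at hdiff
  exact (basisState_injective (smul_right_injective _ (by norm_num) hdiff)).symm

end Counterexample

end QDisc

theorem mainTheorem1_general :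
    (∀ (d n : ℕ) (S : QDisc.Ensemble d n) (σ : Fin n → QDisc.Op d) (r : Fin n → ℝ)
        (M : Fin n → QDisc.Op d) (N : QDisc.Channel d),
      (∀ x ∈ QDisc.identified M, d ≤ (M x).rank + 1) → S.IsComplementary σ r → S.IsOptimal M →
        (S.Preserves N M ↔ S.OMPCondition N M σ r)) ∧
    (∀ (d n : ℕ) (S : QDisc.Ensemble d n) (σ : Fin n → QDisc.Op d) (r : Fin n → ℝ)
        (M : Fin n → QDisc.Op d) (N : QDisc.Channel d),
      S.IsComplementary σ r → S.IsOptimal M →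
        S.OMPCondition N M σ r → S.Preserves N M) ∧
    (∀ d : ℕ, 2 < d →
      ∃ (n : ℕ) (S : QDisc.Ensemble d n) (σ : Fin n → QDisc.Op d) (r : Fin n → ℝ)
        (M : Fin n → QDisc.Op d) (N : QDisc.Channel d),
      S.IsComplementary σ r ∧ S.IsOptimal M ∧
        S.Preserves N M ∧ ¬ S.OMPCondition N M σ r) :=
  ⟨fun _ _ _ _ _ _ _ hrank h hM =>
      ⟨fun hN => hN.ompCondition h hrank, fun hC => hC.preserves h hM⟩,
    fun _ _ _ _ _ _ _ h hM hC => hC.preserves h hM,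
    fun _ hd => QDisc.exists_preserves_not_ompCondition hd⟩

theorem mainTheorem1 :
    -- qubit ensembles: the condition is necessary and sufficient
    (∀ (n : ℕ) (S : QDisc.Ensemble 2 n) (σ : Fin n → QDisc.Op 2) (r : Fin n → ℝ)
        (M : Fin n → QDisc.Op 2) (N : QDisc.Channel 2),
      S.IsComplementary σ r → S.IsOptimal M →
        (S.Preserves N M ↔ S.OMPCondition N M σ r)) ∧
    -- arbitrary finite dimension: the condition is sufficient
    (∀ (d n : ℕ) (S : QDisc.Ensemble d n) (σ : Fin n → QDisc.Op d) (r : Fin n → ℝ)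
        (M : Fin n → QDisc.Op d) (N : QDisc.Channel d),
      S.IsComplementary σ r → S.IsOptimal M →
        S.OMPCondition N M σ r → S.Preserves N M) ∧
    -- in every dimension greater than two the condition is not necessary
    (∀ d : ℕ, 2 < d →
      ∃ (n : ℕ) (S : QDisc.Ensemble d n) (σ : Fin n → QDisc.Op d) (r : Fin n → ℝ)
        (M : Fin n → QDisc.Op d) (N : QDisc.Channel d),
      S.IsComplementary σ r ∧ S.IsOptimal M ∧
        S.Preserves N M ∧ ¬ S.OMPCondition N M σ r) := by
  exact ⟨fun n S σ r M N => mainTheorem1_general.1 2 n S σ r M N fun _ hx =>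
    Nat.succ_le_succ (QDisc.rank_pos_of_ne_zero hx), mainTheorem1_general.2⟩
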